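/- Let $k$ be a field, let $n\ge 3$ and $t\ge 2$ be integers, let $R=k[x_1,\dots,x_n]$, and let $I_{n,t}\subseteq R$ be the ideal generated by the $n$ monomials $\prod_{j\ne i}x_j^{t}$, $i=1,\dots,n$. Let $\overline{I}_{n,t}$ be the integral closure of $I_{n,t}$, that is, the ideal of all $f\in R$ satisfying an equation $f^m+a_1f^{m-1}+\dots+a_m=0$ with $m\ge 1$ and $a_i\in I_{n,t}^{\,i}$ for $1\le i\le m$. Then $\overline{I}_{n,t}$ has an embedded prime, that is, $R/\overline{I}_{n,t}$ has an associated prime that is not minimal over $\overline{I}_{n,t}$; and $\overline{I}_{n,t}$ is not Cohen–Macaulay, that is, the ring $R/\overline{I}_{n,t}$ is not Cohen–Macaulay. -/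

import Mathlib

open scoped Polynomial

/-- `x` is integral over the ideal `I`: it satisfies an equation
`x ^ m + a₁ x ^ (m - 1) + ⋯ + aₘ = 0` with `m ≥ 1` and `aᵢ ∈ I ^ i`. -/
def Ideal.IsIntegralOver {R : Type*} [CommRing R] (I : Ideal R) (x : R) : Prop :=
  ∃ m : ℕ, 0 < m ∧ ∃ a : ℕ → R, (∀ i ∈ Finset.Icc 1 m, a i ∈ I ^ i) ∧
    x ^ m + ∑ i ∈ Finset.Icc 1 m, a i * x ^ (m - i) = 0

/-- Integrality of `x` over the ideal `I` is integrality of `x T` over the Rees algebra of `I`. -/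
theorem Ideal.isIntegralOver_iff_isIntegral_monomial {R : Type*} [CommRing R] (I : Ideal R)
    (x : R) :
    I.IsIntegralOver x ↔ IsIntegral (reesAlgebra I) (Polynomial.monomial 1 x : R[X]) := by
  constructor
  · classical
    rintro ⟨m, hm, a, ha, hx⟩
    let b : ℕ → reesAlgebra I := fun i =>
      if h : a i ∈ I ^ i then ⟨Polynomial.monomial i (a i), reesAlgebra.monomial_mem.2 h⟩ else 0
    let q : (reesAlgebra I)[X] :=
      ∑ i ∈ Finset.Icc 1 m, Polynomial.C (b i) * Polynomial.X ^ (m - i)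
    refine ⟨Polynomial.X ^ m + q, Polynomial.monic_X_pow_add ?_, ?_⟩
    · refine (Polynomial.degree_sum_le _ _).trans_lt ?_
      rw [Finset.sup_lt_iff (by exact WithBot.bot_lt_coe m)]
      intro i hi
      rw [Finset.mem_Icc] at hi
      refine (Polynomial.degree_C_mul_X_pow_le _ _).trans_lt ?_
      exact_mod_cast (by omega : m - i < m)
    · have key : ∀ i ∈ Finset.Icc 1 m,
          Polynomial.eval₂ (algebraMap (reesAlgebra I) R[X]) (Polynomial.monomial 1 x)
            (Polynomial.C (b i) * Polynomial.X ^ (m - i))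
          = Polynomial.monomial m (a i * x ^ (m - i)) := by
        intro i hi
        have hb : algebraMap (reesAlgebra I) R[X] (b i) = Polynomial.monomial i (a i) := by
          simp only [b, dif_pos (ha i hi)]
          rfl
        rw [Finset.mem_Icc] at hi
        rw [Polynomial.eval₂_mul, Polynomial.eval₂_C, Polynomial.eval₂_X_pow, hb,
          Polynomial.monomial_pow, Polynomial.monomial_mul_monomial]
        rw [show i + 1 * (m - i) = m by omega]
      simp only [q]
      rw [Polynomial.eval₂_add, Polynomial.eval₂_finsetSum, Finset.sum_congr rfl key,
        Polynomial.eval₂_X_pow, Polynomial.monomial_pow, one_mul, ← map_sum, ← map_add, hx,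
        map_zero]
  · rintro ⟨p, hp, hx⟩
    rcases subsingleton_or_nontrivial R with hR | hR
    · exact ⟨1, one_pos, 0, by simp, Subsingleton.elim _ _⟩
    have hcoef : ∀ i ≤ p.natDegree, (algebraMap (reesAlgebra I) R[X] (p.coeff i) *
        (Polynomial.monomial 1 x) ^ i).coeff p.natDegree
        = (p.coeff i : R[X]).coeff (p.natDegree - i) * x ^ i := by
      intro i hi
      rw [Polynomial.monomial_pow, one_mul]
      obtain ⟨d, hd⟩ := Nat.exists_eq_add_of_le' hi
      rw [hd, Polynomial.coeff_mul_monomial, Nat.add_sub_cancel]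
      rfl
    have h1 := congrArg (fun f : R[X] => f.coeff p.natDegree) hx
    simp only [Polynomial.eval₂_eq_sum_range, Polynomial.finsetSum_coeff,
      Polynomial.coeff_zero] at h1
    rw [Finset.sum_congr rfl fun i hi => hcoef i (by simpa [Nat.lt_succ_iff] using hi),
      Finset.sum_range_succ, Nat.sub_self, Polynomial.coeff_natDegree, hp.leadingCoeff] at h1
    have hone : ((1 : reesAlgebra I) : R[X]).coeff 0 = 1 := by simp
    rw [hone, one_mul] at h1
    have hpos : 0 < p.natDegree := by
      by_contra h0
      have h0' : p.natDegree = 0 := by omega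
      rw [h0'] at h1
      simp at h1
    refine ⟨p.natDegree, hpos,
      fun i => (p.coeff (p.natDegree - i) : R[X]).coeff i, fun i _ => ?_, ?_⟩
    · exact (mem_reesAlgebra_iff I _).1 (p.coeff (p.natDegree - i)).2 i
    · rw [add_comm]
      refine Eq.trans ?_ h1
      congr 1
      refine Finset.sum_bij' (fun i _ => p.natDegree - i) (fun i _ => p.natDegree - i)
        ?_ ?_ ?_ ?_ ?_
      · intro i hi
        simp only [Finset.mem_Icc, Finset.mem_range] at *
        omega
      · intro i hi
        simp only [Finset.mem_Icc, Finset.mem_range] at *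
        omega
      · intro i hi
        simp only [Finset.mem_Icc] at *
        omega
      · intro i hi
        simp only [Finset.mem_range] at *
        omega
      · intro i hi
        simp only [Finset.mem_Icc] at hi
        rw [Nat.sub_sub_self hi.2]

/-- The integral closure of an ideal `I` of `R`: the ideal of all elements of `R` that are
integral over `I`. -/
def Ideal.integralClosure {R : Type*} [CommRing R] (I : Ideal R) : Ideal R where
  carrier := {x | I.IsIntegralOver x}
  zero_mem' := by
    change I.IsIntegralOver 0
    rw [Ideal.isIntegralOver_iff_isIntegral_monomial, map_zero]
    exact isIntegral_zero
  add_mem' := by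
    intro x y hx hy
    change I.IsIntegralOver (x + y)
    change I.IsIntegralOver x at hx
    change I.IsIntegralOver y at hy
    rw [Ideal.isIntegralOver_iff_isIntegral_monomial] at hx hy ⊢
    rw [map_add]
    exact hx.add hy
  smul_mem' := by
    intro c x hx
    change I.IsIntegralOver (c * x)
    change I.IsIntegralOver x at hx
    rw [Ideal.isIntegralOver_iff_isIntegral_monomial] at hx ⊢
    have h : (Polynomial.monomial 1 (c * x) : R[X])
        = algebraMap (reesAlgebra I) R[X] (algebraMap R (reesAlgebra I) c)
          * Polynomial.monomial 1 x := by
      rw [← IsScalarTower.algebraMap_apply, ← Polynomial.C_eq_algebraMap,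
        Polynomial.C_mul_monomial]
    rw [h]
    exact isIntegral_algebraMap.mul hx

/-- The depth of a local ring: the supremum of the lengths of the regular sequences
contained in its maximal ideal. -/
noncomputable def localDepth (A : Type*) [CommRing A] [IsLocalRing A] : ℕ∞ :=
  ⨆ rs : {rs : List A // (∀ r ∈ rs, r ∈ IsLocalRing.maximalIdeal A) ∧
    RingTheory.Sequence.IsRegular A rs}, (rs.1.length : ℕ∞)

/-- A Cohen–Macaulay local ring: a Noetherian local ring whose depth is its Krull dimension. -/
def IsCohenMacaulayLocalRing (A : Type*) [CommRing A] [IsLocalRing A] : Prop :=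
  IsNoetherianRing A ∧ (localDepth A : WithBot ℕ∞) = ringKrullDim A

/-- A Cohen–Macaulay ring: a Noetherian ring whose localization at every maximal ideal is a
Cohen–Macaulay local ring. -/
def IsCohenMacaulayRing (A : Type*) [CommRing A] : Prop :=
  IsNoetherianRing A ∧
    ∀ (m : Ideal A) [m.IsMaximal], IsCohenMacaulayLocalRing (Localization.AtPrime m)

/-- An ideal `I` of `R` is called Cohen–Macaulay if the quotient ring `R ⧸ I` is. -/
def Ideal.IsCohenMacaulay {R : Type*} [CommRing R] (I : Ideal R) : Prop :=
  IsCohenMacaulayRing (R ⧸ I)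

/-- An embedded prime of an ideal `I`: an associated prime of `R ⧸ I` that is not minimal
over `I`. -/
def Ideal.IsEmbeddedPrime {R : Type*} [CommRing R] (I P : Ideal R) : Prop :=
  P ∈ associatedPrimes R (R ⧸ I) ∧ P ∉ I.minimalPrimes

/-- The ideal of `k[x₁, …, xₙ]` generated by the `n` monomials `∏_{j ≠ i} xⱼ ^ t`. -/
noncomputable def monomialIdeal (k : Type*) [Field k] (n t : ℕ) : Ideal (MvPolynomial (Fin n) k) :=
  Ideal.span (Set.range fun i : Fin n =>
    ∏ j ∈ Finset.univ.erase i, (MvPolynomial.X j : MvPolynomial (Fin n) k) ^ t)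

/-!
Write `J` for the integral closure of `I = monomialIdeal k n t`. By the Newton polyhedron of `I`, a
monomial with exponents `a_j` lies in `J` if and only if `∑_j max (0, t - a_j) ≤ t`. Choose three
variables and let `P` be the prime they generate. For the monomial `u` with
exponents `t - 1, t - 1, 1` at these three variables and `t` at the others, the sum above is
`t + 1`, and multiplying `u` by any of the three variables lowers it to `t`, while multiplying
by the other variables does not change it. So `P` is the annihilator of `u` in `R ⧸ J`. It is not
minimal over `J`, because two of the three variables already generate a prime containing `J`.

Only the following part of the description of `J` is needed. The products of `u` with the three
variables lie in `J` because their `t`-th powers are products of `t` generators of `I`.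
Conversely, `I` vanishes to order at least `2 t` along the coordinate subspace where the three
variables vanish, and the order of vanishing is a valuation, so the same holds for `J`
(`X_pow_dvd_scaleBy_of_mem_integralClosure`). But `f * u` has order `2 t - 1` when `f ∉ P`. This is
`isEmbeddedPrime_ker_zeroOut`.

A Cohen–Macaulay ring has no embedded primes, since the depth of a Noetherian local ring `A` is at
most the dimension of `A ⧸ p` for every associated prime `p` (`localDepth_le_coheight`), and this is
smaller than the dimension of `A` if `p` is not minimal. The bound follows by induction along a
regular sequence from `exists_mem_associatedPrimes_quotSMulTop`.
-/

/-! ### Depth and associated primes -/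

section Depth

open RingTheory.Sequence
open scoped Pointwise

variable {A : Type*} [CommRing A] [IsLocalRing A]

/-- The submodule `N` of elements killed by `p` is not contained in `r M`: since `r` is regular on
`M`, this would give `N = r N`, hence `N = 0` by Nakayama's lemma. A maximal annihilator above that
of an element of `N` outside `r M` is the required prime. -/
theorem exists_mem_associatedPrimes_quotSMulTop [IsNoetherianRing A] {M : Type*}
    [AddCommGroup M] [Module A M] [Module.Finite A M] {p : Ideal A}
    (hp : p ∈ associatedPrimes A M) {r : A}
    (hr : r ∈ IsLocalRing.maximalIdeal A) (hreg : IsSMulRegular M r) :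
    ∃ q ∈ associatedPrimes A (QuotSMulTop r M), p < q := by
  obtain ⟨hprime, u, hu⟩ := isAssociatedPrime_iff.1 hp
  have hpu : ∀ x : A, x ∈ p ↔ x • u = 0 := by
    intro x
    rw [hu]
    exact Submodule.mem_colon_singleton.trans (Submodule.mem_bot A)
  have hu0 : u ≠ 0 := fun h => hprime.ne_top ((Ideal.eq_top_iff_one p).2 ((hpu 1).2 (by simp [h])))
  let N : Submodule A M := Submodule.torsionBySet A M p
  have huN : u ∈ N := (Submodule.mem_torsionBySet_iff _ _).2 fun x => (hpu x).1 x.2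
  have hN : ∃ v ∈ N, v ∉ r • (⊤ : Submodule A M) := by
    by_contra! hcon
    have hle : N ≤ Ideal.span {r} • N := by
      intro v hv
      obtain ⟨w, -, rfl⟩ := Submodule.mem_smul_pointwise_iff_exists _ _ _ |>.1 (hcon v hv)
      refine Submodule.smul_mem_smul (Ideal.mem_span_singleton_self r) ?_
      refine (Submodule.mem_torsionBySet_iff _ _).2 fun x => hreg ?_
      have := (Submodule.mem_torsionBySet_iff _ _).1 hv x
      simpa [smul_comm r] using this
    have hbot : N = ⊥ := by
      refine Submodule.eq_bot_of_le_smul_of_le_jacobson_bot _ N (IsNoetherian.noetherian N) hle ?_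
      rw [IsLocalRing.jacobson_eq_maximalIdeal _ bot_ne_top, Ideal.span_singleton_le_iff_mem]
      exact hr
    exact hu0 ((Submodule.mem_bot A).1 (hbot ▸ huN))
  obtain ⟨v, hvN, hv⟩ := hN
  let v' : QuotSMulTop r M := Submodule.Quotient.mk v
  have hv' : v' ≠ 0 := fun h => hv ((Submodule.Quotient.mk_eq_zero _).1 h)
  obtain ⟨q, hq, hle⟩ := exists_le_isAssociatedPrime_of_isNoetherianRing A v' hv'
  have hmem : ∀ x : A, x • v' = 0 → x ∈ q := fun x hx =>
    hle (Submodule.mem_colon_singleton.2 ((Submodule.mem_bot A).2 hx))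
  have hrp : r ∉ p := fun h => hu0 (hreg (by simpa using (hpu r).1 h))
  refine ⟨q, hq, lt_of_le_of_ne (fun x hx => hmem x ?_) ?_⟩
  · change Submodule.Quotient.mk (x • v) = _
    rw [(Submodule.mem_torsionBySet_iff _ _).1 hvN ⟨x, hx⟩]
    rfl
  · rintro rfl
    refine hrp (hmem r ?_)
    exact (Submodule.Quotient.mk_eq_zero _).2
      (Submodule.smul_mem_pointwise_smul v r ⊤ Submodule.mem_top)

/-- A weakly regular sequence of length `d` on `M` yields a chain of `d` strict inclusions of primes
above any associated prime of `M`. -/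
theorem length_le_coheight_of_mem_associatedPrimes [IsNoetherianRing A] (rs : List A) :
    ∀ {M : Type*} [AddCommGroup M] [Module A M] [Module.Finite A M] (p : PrimeSpectrum A),
      p.asIdeal ∈ associatedPrimes A M → (∀ r ∈ rs, r ∈ IsLocalRing.maximalIdeal A) →
      IsWeaklyRegular M rs → (rs.length : ℕ∞) ≤ Order.coheight p := by
  induction rs with
  | nil => intros; simp
  | cons r rs ih =>
    intro M _ _ _ p hp hrs hreg
    rw [isWeaklyRegular_cons_iff] at hreg
    obtain ⟨q, hq, hpq⟩ :=
      exists_mem_associatedPrimes_quotSMulTop hp (hrs r List.mem_cons_self) hreg.1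
    let q' : PrimeSpectrum A := ⟨q, hq.1⟩
    have h1 := ih q' hq (fun x hx => hrs x (List.mem_cons_of_mem _ hx)) hreg.2
    have h2 : Order.coheight q' + 1 ≤ Order.coheight p := Order.coheight_add_one_le hpq
    rw [List.length_cons, Nat.cast_add, Nat.cast_one]
    exact (add_le_add_left h1 1).trans h2

/-- The depth is at most the dimension of `A ⧸ p` (here the coheight of `p`) for every associated
prime `p`. -/
theorem localDepth_le_coheight [IsNoetherianRing A] (p : PrimeSpectrum A)
    (hp : p.asIdeal ∈ associatedPrimes A A) :
    localDepth A ≤ Order.coheight p :=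
  iSup_le fun rs =>
    length_le_coheight_of_mem_associatedPrimes rs.1 p hp rs.2.1 rs.2.2.toIsWeaklyRegular

theorem IsCohenMacaulayLocalRing.isMin_of_mem_associatedPrimes (h : IsCohenMacaulayLocalRing A)
    (p : PrimeSpectrum A) (hp : p.asIdeal ∈ associatedPrimes A A) : IsMin p := by
  have := h.1
  by_contra hmin
  obtain ⟨q, hqp⟩ := not_isMin_iff.1 hmin
  have hdim : ((Order.coheight p + 1 : ℕ∞) : WithBot ℕ∞) ≤ Order.coheight p :=
    calc ((Order.coheight p + 1 : ℕ∞) : WithBot ℕ∞)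
      _ ≤ Order.coheight q := WithBot.coe_le_coe.2 (Order.coheight_add_one_le hqp)
      _ ≤ ringKrullDim A := Order.coheight_le_krullDim q
      _ = localDepth A := h.2.symm
      _ ≤ Order.coheight p := WithBot.coe_le_coe.2 (localDepth_le_coheight p hp)
  have hfin : Order.coheight p ≠ ⊤ := by
    intro htop
    have h1 : ((⊤ : ℕ∞) : WithBot ℕ∞) ≤ ringKrullDim A := htop ▸ Order.coheight_le_krullDim p
    exact absurd (ringKrullDim_lt_top (R := A)) (not_lt.2 h1)
  exact absurd (WithBot.coe_le_coe.1 hdim) (not_le.2 (ENat.lt_add_one_iff hfin |>.2 le_rfl))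

end Depth

/-- A Cohen–Macaulay ring has no embedded primes: localize at a maximal ideal above the given
associated prime. -/
theorem IsCohenMacaulayRing.mem_minimalPrimes_of_mem_associatedPrimes {B : Type*} [CommRing B]
    (h : IsCohenMacaulayRing B) {p : Ideal B} (hp : p ∈ associatedPrimes B B) :
    p ∈ minimalPrimes B := by
  have hprime : p.IsPrime := hp.1
  obtain ⟨m, hm, hpm⟩ := p.exists_le_maximal hprime.ne_top
  let A := Localization.AtPrime m
  have hdisj : ∀ q : Ideal B, q ≤ p → Disjoint (m.primeCompl : Set B) q := fun q hq =>
    Set.disjoint_left.2 fun x hx hxq => hx (hpm (hq hxq))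
  have hcomap : ∀ q : Ideal B, q.IsPrime → q ≤ p →
      (q.map (algebraMap B A)).comap (algebraMap B A) = q := fun q hq hqp =>
    IsLocalization.under_map_of_isPrime_disjoint m.primeCompl A hq (hdisj q hqp)
  have hmap : ∀ q : Ideal B, q.IsPrime → q ≤ p → (q.map (algebraMap B A)).IsPrime :=
    fun q hq hqp => IsLocalization.isPrime_of_isPrime_disjoint m.primeCompl A q hq (hdisj q hqp)
  have hass : p.map (algebraMap B A) ∈ associatedPrimes A A := by
    open Module.associatedPrimes in
    refine mem_associatedPrimes_of_comap_mem_associatedPrimes_of_isLocalizedModule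
      m.primeCompl (Algebra.linearMap B A) _ ?_
    rwa [hcomap p hprime le_rfl]
  have hmin := (h.2 m).isMin_of_mem_associatedPrimes ⟨_, hmap p hprime le_rfl⟩ hass
  refine ⟨⟨hprime, bot_le⟩, fun q hq hqp => ?_⟩
  have hle : p.map (algebraMap B A) ≤ q.map (algebraMap B A) :=
    hmin (b := ⟨_, hmap q hq.1 hqp⟩) (Ideal.map_mono hqp)
  rw [← hcomap q hq.1 hqp, ← hcomap p hprime le_rfl]
  exact Ideal.comap_mono hle

theorem Ideal.IsEmbeddedPrime.not_isCohenMacaulay {R : Type*} [CommRing R] [IsNoetherianRing R]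
    {I P : Ideal R} (hP : I.IsEmbeddedPrime P) : ¬ I.IsCohenMacaulay := by
  intro h
  obtain ⟨hass, hmin⟩ := hP
  obtain ⟨hprime, u, hu⟩ := isAssociatedPrime_iff.1 hass
  have hPu : ∀ x : R, x ∈ P ↔ Ideal.Quotient.mk I x * u = 0 := by
    intro x
    rw [hu]
    exact Submodule.mem_colon_singleton.trans (Submodule.mem_bot R)
  have hIP : I ≤ P := fun x hx => (hPu x).2 (by
    rw [Ideal.Quotient.eq_zero_iff_mem.2 hx, zero_mul])
  have hsurj := Ideal.Quotient.mk_surjective (I := I)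
  have hcomap : (P.map (Ideal.Quotient.mk I)).comap (Ideal.Quotient.mk I) = P := by
    rw [Ideal.comap_map_of_surjective' _ hsurj, Ideal.mk_ker, sup_eq_left.2 hIP]
  refine hmin ?_
  rw [Ideal.minimalPrimes_eq_comap]
  refine ⟨_, h.mem_minimalPrimes_of_mem_associatedPrimes (isAssociatedPrime_iff.2
    ⟨Ideal.map_isPrime_of_surjective hsurj (by rwa [Ideal.mk_ker]), u, ?_⟩), hcomap⟩
  ext y
  obtain ⟨x, rfl⟩ := hsurj y
  rw [← Ideal.mem_comap, hcomap, hPu, Submodule.mem_colon_singleton, Submodule.mem_bot, smul_eq_mul]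

/-! ### Integral closure of ideals -/

theorem Ideal.IsIntegralOver.map {R S : Type*} [CommRing R] [CommRing S] {I : Ideal R} {x : R}
    (hx : I.IsIntegralOver x) (f : R →+* S) : (I.map f).IsIntegralOver (f x) := by
  obtain ⟨m, hm, a, ha, h⟩ := hx
  refine ⟨m, hm, fun i => f (a i), fun i hi => ?_, ?_⟩
  · rw [← Ideal.map_pow]
    exact Ideal.mem_map_of_mem f (ha i hi)
  · simpa using congrArg f h

theorem Ideal.IsIntegralOver.mono {R : Type*} [CommRing R] {I J : Ideal R} (hIJ : I ≤ J) {x : R}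
    (hx : I.IsIntegralOver x) : J.IsIntegralOver x := by
  obtain ⟨m, hm, a, ha, h⟩ := hx
  exact ⟨m, hm, a, fun i hi => Ideal.pow_right_mono hIJ i (ha i hi), h⟩

theorem Ideal.isIntegralOver_of_pow_mem {R : Type*} [CommRing R] {I : Ideal R} {x : R} {m : ℕ}
    (hm : 0 < m) (hx : x ^ m ∈ I ^ m) : I.IsIntegralOver x := by
  refine ⟨m, hm, Pi.single m (-x ^ m), fun i _ => ?_, ?_⟩
  · rcases eq_or_ne i m with rfl | hi
    · simpa using hx
    · simp [hi]
  · rw [Finset.sum_eq_single_of_mem m (Finset.mem_Icc.2 ⟨hm, le_rfl⟩)]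
    · simp
    · intro i _ hi
      simp [hi]

theorem Ideal.integralClosure_le_radical {R : Type*} [CommRing R] (I : Ideal R) :
    I.integralClosure ≤ I.radical := by
  rintro x ⟨m, hm, a, ha, h⟩
  refine ⟨m, ?_⟩
  rw [eq_neg_of_add_eq_zero_left h]
  refine I.neg_mem (I.sum_mem fun i hi => I.mul_mem_right _ ?_)
  exact Ideal.pow_le_self (by have := (Finset.mem_Icc.1 hi).1; omega) (ha i hi)

/-- Powers of a principal prime ideal of a domain are integrally closed, because the order of
vanishing at the prime is a valuation. -/
theorem Prime.pow_dvd_of_isIntegralOver {D : Type*} [CommRing D] [IsDomain D] {p : D}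
    (hp : Prime p) {c : ℕ} {y : D} (hy : (Ideal.span {p ^ c}).IsIntegralOver y) : p ^ c ∣ y := by
  obtain ⟨m, hm, a, ha, h⟩ := hy
  suffices H : ∀ d ≤ c, p ^ d ∣ y from H c le_rfl
  intro d
  induction d with
  | zero => simp
  | succ d ih =>
    intro hd
    obtain ⟨g, rfl⟩ := ih (by omega)
    -- Every other term of the equation is divisible by one more power of `p` than `p ^ (d * m)`.
    have hsum : p ^ (d * m + 1) ∣ (p ^ d * g) ^ m := by
      rw [eq_neg_of_add_eq_zero_left h, dvd_neg]
      refine Finset.dvd_sum fun i hi => ?_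
      have hai := ha i hi
      rw [Ideal.span_singleton_pow, Ideal.mem_span_singleton] at hai
      rw [Finset.mem_Icc] at hi
      have hpow : p ^ (d * m + 1) ∣ (p ^ c) ^ i * (p ^ d) ^ (m - i) := by
        rw [← pow_mul, ← pow_mul, ← pow_add]
        refine pow_dvd_pow p ?_
        obtain ⟨e, rfl⟩ := Nat.exists_eq_add_of_le hi.2
        rw [Nat.add_sub_cancel_left]
        nlinarith
      refine hpow.trans (mul_dvd_mul hai ?_)
      rw [mul_pow]
      exact dvd_mul_right _ _
    rw [mul_pow, ← pow_mul, pow_succ] at hsum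
    have hg : p ∣ g := hp.dvd_of_dvd_pow
      ((mul_dvd_mul_iff_left (pow_ne_zero _ hp.ne_zero)).1 hsum)
    rw [pow_succ]
    exact mul_dvd_mul_left _ hg

/-! ### An embedded prime of the integral closure -/

section Monomial

open MvPolynomial

variable {k : Type*} [Field k] {n : ℕ}

/-- The substitution `x_j ↦ 0` for `j ∈ S`, with the other variables fixed. -/
noncomputable def zeroOut (k : Type*) [Field k] {n : ℕ} (S : Finset (Fin n)) :
    MvPolynomial (Fin n) k →ₐ[k] MvPolynomial (Fin n) k :=
  aeval fun j => if j ∈ S then 0 else X j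

/-- The substitution `x_j ↦ T x_j` for `j ∈ S`, with the other variables fixed; the order in `T` of
the image of `f` is the order of `f` along the coordinate subspace `x_j = 0`, `j ∈ S`. -/
noncomputable def scaleBy (k : Type*) [Field k] {n : ℕ} (S : Finset (Fin n)) :
    MvPolynomial (Fin n) k →ₐ[k] (MvPolynomial (Fin n) k)[X] :=
  aeval fun j => if j ∈ S then Polynomial.X * Polynomial.C (X j) else Polynomial.C (X j)

theorem zeroOut_X (S : Finset (Fin n)) (j : Fin n) :
    zeroOut k S (X j) = if j ∈ S then 0 else X j := aeval_X _ _

theorem scaleBy_X (S : Finset (Fin n)) (j : Fin n) :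
    scaleBy k S (X j) = Polynomial.X ^ (if j ∈ S then 1 else 0) * Polynomial.C (X j) := by
  rw [scaleBy, aeval_X]
  split <;> simp

theorem eval_zero_scaleBy (S : Finset (Fin n)) (f : MvPolynomial (Fin n) k) :
    (scaleBy k S f).eval 0 = zeroOut k S f := by
  have h : ((Polynomial.aeval (R := MvPolynomial (Fin n) k) 0).restrictScalars k).comp
      (scaleBy k S) = zeroOut k S := by
    ext j : 1
    simp [scaleBy_X, zeroOut_X]
    split <;> simp
  rw [← h]
  simp

theorem ker_zeroOut (S : Finset (Fin n)) :
    RingHom.ker (zeroOut k S) = Ideal.span (X '' (S : Set (Fin n))) := by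
  apply le_antisymm
  · intro f hf
    have h : (Ideal.Quotient.mkₐ k (Ideal.span (X '' (S : Set (Fin n))))).comp (zeroOut k S)
        = Ideal.Quotient.mkₐ k (Ideal.span (X '' (S : Set (Fin n)))) := by
      ext j : 1
      simp only [AlgHom.comp_apply, zeroOut_X]
      split_ifs with hj
      · rw [map_zero, eq_comm]
        exact Ideal.Quotient.eq_zero_iff_mem.2 (Ideal.subset_span ⟨j, hj, rfl⟩)
      · rfl
    have h2 := DFunLike.congr_fun h f
    rw [AlgHom.comp_apply, (RingHom.mem_ker).1 hf, map_zero] at h2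
    exact Ideal.Quotient.eq_zero_iff_mem.1 h2.symm
  · rw [Ideal.span_le]
    rintro _ ⟨j, hj, rfl⟩
    exact (RingHom.mem_ker).2 ((zeroOut_X S j).trans (if_pos hj))

theorem prod_erase_X_pow {a b c : Fin n} (hab : a ≠ b) (hac : a ≠ c) (hbc : b ≠ c) (t : ℕ) :
    ∏ j ∈ Finset.univ.erase a, (X j : MvPolynomial (Fin n) k) ^ t =
      (X b * X c * ∏ j ∈ Finset.univ \ {a, b, c}, X j) ^ t := by
  rw [Finset.prod_pow]
  congr 1
  have h : Finset.univ.erase a = insert b (insert c (Finset.univ \ {a, b, c})) := by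
    ext j; simp; grind
  rw [h, Finset.prod_insert (by simp [hbc]), Finset.prod_insert (by simp), mul_assoc]

/-- The inequalities `∑_{j ∈ S} a_j ≥ 2 t` of the Newton polyhedron, for `#S = 3`: each generator
vanishes to order at least `2 t` along a coordinate subspace of codimension three, hence so does
each element of the integral closure. -/
theorem X_pow_dvd_scaleBy_of_mem_integralClosure {t : ℕ} {S : Finset (Fin n)} (hS : S.card = 3)
    {f : MvPolynomial (Fin n) k} (hf : f ∈ (monomialIdeal k n t).integralClosure) :
    (Polynomial.X : (MvPolynomial (Fin n) k)[X]) ^ (2 * t) ∣ scaleBy k S f := by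
  have hmap := Ideal.IsIntegralOver.map hf (scaleBy k S : _ →+* (MvPolynomial (Fin n) k)[X])
  refine Polynomial.prime_X.pow_dvd_of_isIntegralOver (hmap.mono ?_)
  rw [monomialIdeal, Ideal.map_span, Ideal.span_le]
  rintro _ ⟨_, ⟨i, rfl⟩, rfl⟩
  rw [SetLike.mem_coe, Ideal.mem_span_singleton]
  simp only [RingHom.coe_coe, map_prod, map_pow, scaleBy_X, mul_pow, ← pow_mul,
    Finset.prod_mul_distrib, Finset.prod_pow_eq_pow_sum, ← Finset.sum_mul]
  refine (pow_dvd_pow _ (Nat.mul_le_mul_right t ?_)).mul_right _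
  rw [Finset.sum_ite_mem, Finset.sum_const, smul_eq_mul, mul_one, Finset.erase_inter,
    Finset.univ_inter]
  have := Finset.pred_card_le_card_erase (s := S) (a := i)
  omega

/-- The exponents of `u = x_a ^ (s + 1) x_b ^ (s + 1) x_c w ^ (s + 2)`, where `w` is the product of
the remaining variables, sum to `2 t - 1` over `a, b, c`, with `t = s + 2`; so `u` lies just outside
the integral closure, and multiplying it by any of `x_a, x_b, x_c` brings it inside. -/
theorem isEmbeddedPrime_ker_zeroOut (s : ℕ) {a b c : Fin n} (hab : a ≠ b) (hac : a ≠ c)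
    (hbc : b ≠ c) :
    (monomialIdeal k n (s + 2)).integralClosure.IsEmbeddedPrime
      (RingHom.ker (zeroOut k {a, b, c})) := by
  set I := monomialIdeal k n (s + 2) with hI
  set w : MvPolynomial (Fin n) k := ∏ j ∈ Finset.univ \ {a, b, c}, X j with hw
  set u : MvPolynomial (Fin n) k := X a ^ (s + 1) * X b ^ (s + 1) * X c * w ^ (s + 2) with hu
  have hgen : ∀ i, ∏ j ∈ Finset.univ.erase i, (X j : MvPolynomial (Fin n) k) ^ (s + 2) ∈ I :=
    fun i => Ideal.subset_span ⟨i, rfl⟩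
  have hA : (X b * X c * w) ^ (s + 2) ∈ I := by
    have := hgen a
    rwa [prod_erase_X_pow hab hac hbc] at this
  have hB : (X a * X c * w) ^ (s + 2) ∈ I := by
    have := hgen b
    rwa [prod_erase_X_pow hab.symm hbc hac, Finset.insert_comm b a] at this
  have hC : (X a * X b * w) ^ (s + 2) ∈ I := by
    have := hgen c
    rwa [prod_erase_X_pow hac.symm hbc.symm hab, Finset.insert_comm c a, Finset.pair_comm c b]
      at this
  have huX : ∀ j ∈ ({a, b, c} : Finset (Fin n)), X j * u ∈ I.integralClosure := by
    intro j hj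
    -- The `t`-th power of each of the three monomials is a product of `t` generators.
    refine Ideal.isIntegralOver_of_pow_mem (m := s + 2) (by omega) ?_
    simp only [Finset.mem_insert, Finset.mem_singleton] at hj
    rcases hj with rfl | rfl | rfl
    · have h := Ideal.mul_mem_mul (Ideal.pow_mem_pow hC (s + 1)) hB
      rw [← pow_succ] at h
      convert h using 1
      ring
    · have h := Ideal.mul_mem_mul (Ideal.pow_mem_pow hC (s + 1)) hA
      rw [← pow_succ] at h
      convert h using 1
      ring
    · have h := Ideal.mul_mem_mul (Ideal.mul_mem_mul (Ideal.pow_mem_pow hC s) hA) hB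
      rw [← pow_succ, ← pow_succ] at h
      convert h using 1
      ring
  have hw0 : w ≠ 0 := Finset.prod_ne_zero_iff.2 fun j _ => X_ne_zero j
  have hu0 : u ≠ 0 := by simp [hu, hw0, X_ne_zero]
  have hscale : scaleBy k {a, b, c} u = Polynomial.X ^ (2 * s + 3) * Polynomial.C u := by
    have hsw : scaleBy k {a, b, c} w = Polynomial.C w := by
      rw [hw, map_prod, map_prod]
      refine Finset.prod_congr rfl fun j hj => ?_
      rw [scaleBy_X, if_neg (Finset.mem_sdiff.1 hj).2, pow_zero, one_mul]
    simp only [hu, map_mul, map_pow, hsw, scaleBy_X]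
    simp
    ring
  have hcolon : ∀ f, f * u ∈ I.integralClosure ↔ f ∈ RingHom.ker (zeroOut k {a, b, c}) := by
    intro f
    constructor
    · intro hf
      have h := X_pow_dvd_scaleBy_of_mem_integralClosure
        (Finset.card_eq_three.2 ⟨a, b, c, hab, hac, hbc, rfl⟩) hf
      rw [map_mul, hscale, mul_left_comm, show 2 * (s + 2) = 2 * s + 3 + 1 by ring, pow_succ,
        mul_dvd_mul_iff_left (pow_ne_zero _ Polynomial.X_ne_zero), Polynomial.X_dvd_iff,
        Polynomial.coeff_zero_eq_eval_zero, Polynomial.eval_mul, Polynomial.eval_C,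
        eval_zero_scaleBy] at h
      exact (RingHom.mem_ker).2 ((mul_eq_zero.1 h).resolve_right hu0)
    · intro hf
      rw [ker_zeroOut] at hf
      have hle : Ideal.span (X '' (({a, b, c} : Finset (Fin n)) : Set (Fin n))) ≤
          Submodule.comap (LinearMap.mulRight (MvPolynomial (Fin n) k) u) I.integralClosure := by
        rw [Ideal.span_le]
        rintro _ ⟨j, hj, rfl⟩
        exact huX j hj
      exact hle hf
  refine ⟨isAssociatedPrime_iff.2 ⟨RingHom.ker_isPrime _,
    Ideal.Quotient.mk I.integralClosure u, ?_⟩, ?_⟩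
  · ext f
    rw [← hcolon, Submodule.mem_colon_singleton, Submodule.mem_bot,
      ← Ideal.Quotient.eq_zero_iff_mem, map_mul]
    rfl
  · intro hmin
    have hle : RingHom.ker (zeroOut k {a, b}) ≤ RingHom.ker (zeroOut k {a, b, c}) := by
      rw [ker_zeroOut, ker_zeroOut]
      exact Ideal.span_mono (Set.image_mono (by intro j; simp; tauto))
    have hprime : (RingHom.ker (zeroOut k {a, b} : _ →ₐ[k] MvPolynomial (Fin n) k)).IsPrime :=
      RingHom.ker_isPrime _
    have hJ : I.integralClosure ≤ RingHom.ker (zeroOut k {a, b}) := by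
      refine I.integralClosure_le_radical.trans (hprime.radical_le_iff.2 ?_)
      rw [hI, monomialIdeal, Ideal.span_le]
      rintro _ ⟨i, rfl⟩
      obtain ⟨j, hj, hji⟩ : ∃ j ∈ ({a, b} : Finset (Fin n)), j ≠ i := by
        by_cases h : a = i
        · exact ⟨b, by simp, by rw [← h]; exact hab.symm⟩
        · exact ⟨a, by simp, h⟩
      refine (RingHom.mem_ker).2 ?_
      rw [map_prod]
      refine Finset.prod_eq_zero (Finset.mem_erase.2 ⟨hji, Finset.mem_univ j⟩) ?_
      rw [map_pow, zeroOut_X, if_pos hj, zero_pow (by omega)]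
    have hc : (X c : MvPolynomial (Fin n) k) ∈ RingHom.ker (zeroOut k {a, b}) :=
      hmin.2 ⟨hprime, hJ⟩ hle ((RingHom.mem_ker).2 (by rw [zeroOut_X]; simp))
    rw [RingHom.mem_ker, zeroOut_X, if_neg (by simp [hac.symm, hbc.symm])] at hc
    exact X_ne_zero c hc

end Monomial

theorem mainTheorem3 (k : Type*) [Field k] (n t : ℕ) (hn : 3 ≤ n) (ht : 2 ≤ t) :
    (∃ P : Ideal (MvPolynomial (Fin n) k),
      (monomialIdeal k n t).integralClosure.IsEmbeddedPrime P) ∧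
    ¬ (monomialIdeal k n t).integralClosure.IsCohenMacaulay := by
  obtain ⟨s, rfl⟩ := Nat.exists_eq_add_of_le' ht
  have hP := isEmbeddedPrime_ker_zeroOut (k := k) s
    (a := ⟨0, by omega⟩) (b := ⟨1, by omega⟩) (c := (⟨2, by omega⟩ : Fin n))
    (by simp) (by simp) (by simp)
  exact ⟨⟨_, hP⟩, hP.not_isCohenMacaulay⟩
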